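/- **Definitions.** Let $S$ be a set of points in the Euclidean plane, $d$ the Euclidean distance, and let $H$ be a graph with vertex set $S$ whose edges are drawn as straight segments; the weight of an edge $\{u,v\}$ is $d(u,v)$. For a path $P$ in $H$ between $u$ and $v$, viewed as a polygonal curve, put $d_H(P,\overline{uv})=\max\{d(p,\overline{uv}) : p\in P\}$, where $\overline{uv}$ is the segment between $u$ and $v$ and $d(p,\overline{uv})$ is the distance from $p$ to that segment. For real $t\ge 1$, $H$ is a *$t$-spanner* if any two points $u,v\in S$ are joined in $H$ by a path of total length at most $t\cdot d(u,v)$. For real $\varepsilon\ge 0$, $H$ is an *$\varepsilon$-Hausdorff-spanner* if any two points $u,v\in S$ are joined in $H$ by a path $P$ with $d_H(P,\overline{uv})\le \varepsilon\cdot d(u,v)$. The Koch graphs $F_0,F_1,\dots$ are defined as follows. $F_0$ has the vertices $(0,0)$ and $(1,0)$ and the single edge between them. $F_{n+1}$ arises from $F_n$ by replacing every edge, directed along the curve from $(0,0)$ to $(1,0)$, say from $p$ to $q$, by the four edges of the polygonal path $p,a,m,b,q$, where $a=p+\frac13(q-p)$, $b=p+\frac23(q-p)$, and $m$ is the apex of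 the equilateral triangle with base $\overline{ab}$ that lies to the left of the directed edge $pq$ (the outer side). **Theorem.** For every $n\ge 0$, the graph $F_n$ is finite, its straight-line drawing is plane (no edge passes through a vertex other than its endpoints, and distinct edges meet only in common endpoints), and $F_n$ is a $6$-Hausdorff-spanner. For every real $t\ge 1$ there is an $n$ such that $F_n$ is not a $t$-spanner. In particular, there is a constant $c>0$, namely $c=6$, such that for every $t\ge 1$ there is a finite plane geometric graph that is a $c$-Hausdorff-spanner but not a $t$-spanner. -/

import Mathlib

namespace HausdorffSpanner

/-- The Euclidean plane. -/
abbrev Plane : Type := EuclideanSpace ℝ (Fin 2)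

section Geometric

/-! A subgraph of the Euclidean graph over a point set `S` is a simple graph on `S`; the edge
between `u` and `v` is realised by the straight segment, and its weight is `dist u v`. -/

variable {S : Set Plane} {H : SimpleGraph S}

/-- The Euclidean length of a walk. -/
noncomputable def walkLength : {u v : S} → H.Walk u v → ℝ
  | _, _, .nil => 0
  | u, _, .cons (v := w) _ p => dist (u : Plane) (w : Plane) + walkLength p

/-- The polygonal curve in the plane drawn by a walk (a single point for the trivial walk). -/
def walkTrace : {u v : S} → H.Walk u v → Set Plane
  | u, _, .nil => {(u : Plane)}
  | u, _, .cons (v := w) _ p => segment ℝ (u : Plane) (w : Plane) ∪ walkTrace p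

/-- The Hausdorff distance `max {d(x, uv) | x ∈ P(u,v)}` between a polygonal path `P(u,v)`
and the segment `uv` joining its endpoints. The maximum exists, see `isGreatest_pathDist`. -/
noncomputable def pathDist {u v : S} (p : H.Walk u v) : ℝ :=
  sSup ((fun x : Plane => Metric.infDist x (segment ℝ (u : Plane) (v : Plane))) '' walkTrace p)

theorem isCompact_walkTrace {u v : S} (p : H.Walk u v) : IsCompact (walkTrace p) := by
  induction p with
  | nil => exact isCompact_singleton
  | cons h p ih =>
    refine IsCompact.union ?_ ih
    rw [segment_eq_image_lineMap]
    exact isCompact_Icc.image (by fun_prop)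

theorem walkTrace_nonempty {u v : S} (p : H.Walk u v) : (walkTrace p).Nonempty := by
  cases p with
  | nil => exact Set.singleton_nonempty _
  | cons h p => exact ⟨_, Or.inl (left_mem_segment ℝ _ _)⟩

theorem isGreatest_pathDist {u v : S} (p : H.Walk u v) :
    IsGreatest
      ((fun x : Plane => Metric.infDist x (segment ℝ (u : Plane) (v : Plane))) '' walkTrace p)
      (pathDist p) :=
  ((isCompact_walkTrace p).image (Metric.continuous_infDist_pt _)).isGreatest_sSup
    ((walkTrace_nonempty p).image _)

/-- `H` is a `t`-spanner of `S`: any two points of `S` are joined in `H` by a path of length at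
most `t` times their distance. -/
def IsSpanner (t : ℝ) (H : SimpleGraph S) : Prop :=
  ∀ u v : S, ∃ p : H.Walk u v, p.IsPath ∧ walkLength p ≤ t * dist (u : Plane) (v : Plane)

/-- `H` is an `ε`-Hausdorff-spanner of `S`: any two points of `S` are joined in `H` by a path
whose Hausdorff distance to the segment between them is at most `ε` times their distance. -/
def IsHausdorffSpanner (ε : ℝ) (H : SimpleGraph S) : Prop :=
  ∀ u v : S, ∃ p : H.Walk u v, p.IsPath ∧ pathDist p ≤ ε * dist (u : Plane) (v : Plane)

/-- The straight-line drawing of `H` is plane: no edge passes through a vertex other than its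
endpoints, and two distinct edges meet only in common endpoints. -/
def IsPlaneDrawing (H : SimpleGraph S) : Prop :=
  (∀ a b w : S, H.Adj a b → (w : Plane) ∈ segment ℝ (a : Plane) (b : Plane) → w = a ∨ w = b) ∧
  ∀ a b c d : S, H.Adj a b → H.Adj c d → s(a, b) ≠ s(c, d) →
    segment ℝ (a : Plane) (b : Plane) ∩ segment ℝ (c : Plane) (d : Plane) ⊆
      {(a : Plane), (b : Plane)} ∩ {(c : Plane), (d : Plane)}

end Geometric

section Koch

/-- Counterclockwise rotation by a right angle. -/
noncomputable def rot (x : Plane) : Plane := !₂[-x 1, x 0]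

/-- The apex of the equilateral triangle whose base is the middle third of `pq`, on the left of
`pq`: it lies above the midpoint of `pq` at height `(√3 / 2) * (|pq| / 3)`. -/
noncomputable def apex (p q : Plane) : Plane :=
  midpoint ℝ p q + (√3 / 6) • rot (q - p)

/-- The four edges replacing an edge, in order. -/
noncomputable def refineEdge (e : Plane × Plane) : List (Plane × Plane) :=
  let a := AffineMap.lineMap e.1 e.2 (1 / 3 : ℝ)
  let b := AffineMap.lineMap e.1 e.2 (2 / 3 : ℝ)
  let m := apex e.1 e.2
  [(e.1, a), (a, m), (m, b), (b, e.2)]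

/-- The edges of the Koch graph `F n`, in order along the curve and directed from the endpoint
`(0, 0)` towards the endpoint `(1, 0)`; the outer side of every edge is its left side. -/
noncomputable def kochEdges : ℕ → List (Plane × Plane)
  | 0 => [(!₂[0, 0], !₂[1, 0])]
  | n + 1 => (kochEdges n).flatMap refineEdge

/-- The vertices of `F n`: all endpoints of its edges. -/
def kochVertices (n : ℕ) : Set Plane :=
  {x | ∃ e ∈ kochEdges n, x = e.1 ∨ x = e.2}

/-- The Koch graph `F n`. -/
def kochGraph (n : ℕ) : SimpleGraph (kochVertices n) :=
  SimpleGraph.fromRel fun u v => ((u : Plane), (v : Plane)) ∈ kochEdges n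

end Koch

end HausdorffSpanner

/-! Over every edge stands an isosceles triangle with base angles of 30°, which contains all later
refinements of that edge (`triangle_subset_of_mem_refineEdge`). Among the triangles of the four new
edges, non-consecutive ones are at least a sixth of the old edge apart, and consecutive ones share
one vertex, at which an angle of at least 60° separates them (`refineEdge_cases`). Any two edges or
vertices are therefore compared at the level where they fall into different children.

Planarity: distinct edges have triangles that meet in common endpoints only
(`eq_endpoint_of_mem_triangles`).

Hausdorff bound (`joined_closedBall`): for far children the old edge has length at most `6 * dist u
v`, and its triangle is no wider than that. For touching children the path runs through the shared
vertex, and each half stays in a ball about that vertex whose radius is three times the distance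
from the vertex to the half's endpoint.

Stretch: arc length along the curve is a potential that grows by at most the length of an edge along
each step of a walk, so any walk between the two ends has length at least `(4 / 3) ^ n`
(`exists_arcLength`, `sub_le_walkLength`). -/

namespace HausdorffSpanner

/-! ### Coordinates relative to an edge, and the triangle over it -/

/-- The point with coordinates `s`, `√3 * t` in the orthogonal frame spanned by the edge `e`. -/
noncomputable def pt (e : Plane × Plane) (s t : ℝ) : Plane :=
  e.1 + s • (e.2 - e.1) + (√3 * t) • rot (e.2 - e.1)

/-- The isosceles triangle with base `e` and apex `apex e.1 e.2`. -/
def triangle (e : Plane × Plane) : Set Plane :=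
  {x | ∃ s t : ℝ, x = pt e s t ∧ 0 ≤ t ∧ 3 * t ≤ s ∧ 3 * t ≤ 1 - s}

theorem pt_zero_zero (e : Plane × Plane) : pt e 0 0 = e.1 := by
  simp [pt]

theorem pt_one_zero (e : Plane × Plane) : pt e 1 0 = e.2 := by
  simp [pt]

/-- With `√3` split off from the second coordinate, changing the frame to a child edge needs
rational coefficients only, so containments become linear arithmetic. -/
theorem pt_pt (e : Plane × Plane) (x y x' y' s t : ℝ) :
    pt (pt e x y, pt e x' y') s t =
      pt e (x + s * (x' - x) - 3 * t * (y' - y)) (y + s * (y' - y) + t * (x' - x)) := by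
  have h3 : √3 * √3 = (3 : ℝ) := Real.mul_self_sqrt (by norm_num)
  ext i
  fin_cases i
  · simp [pt, rot]
    linear_combination (-(e.2.ofLp 0 - e.1.ofLp 0) * t * (y' - y)) * h3
  · simp [pt, rot]
    linear_combination (-(e.2.ofLp 1 - e.1.ofLp 1) * t * (y' - y)) * h3

theorem dist_pt (e : Plane × Plane) (s t s' t' : ℝ) :
    dist (pt e s t) (pt e s' t') = dist e.1 e.2 * √((s - s') ^ 2 + 3 * (t - t') ^ 2) := by
  have h3 : √3 ^ 2 = (3 : ℝ) := Real.sq_sqrt (by norm_num)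
  rw [EuclideanSpace.dist_eq, EuclideanSpace.dist_eq, ← Real.sqrt_mul (by positivity)]
  congr 1
  simp only [Fin.sum_univ_two, Real.dist_eq, sq_abs]
  simp [pt, rot]
  linear_combination
    (((e.2.ofLp 0 - e.1.ofLp 0) ^ 2 + (e.2.ofLp 1 - e.1.ofLp 1) ^ 2) * (t - t') ^ 2) * h3

theorem refineEdge_eq (e : Plane × Plane) :
    refineEdge e = [(pt e 0 0, pt e (1 / 3) 0), (pt e (1 / 3) 0, pt e (1 / 2) (1 / 6)),
      (pt e (1 / 2) (1 / 6), pt e (2 / 3) 0), (pt e (2 / 3) 0, pt e 1 0)] := by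
  have ha (r : ℝ) : AffineMap.lineMap e.1 e.2 r = pt e r 0 := by
    simp [pt, AffineMap.lineMap_apply, add_comm]
  have hm : apex e.1 e.2 = pt e (1 / 2) (1 / 6) := by
    ext i
    fin_cases i <;> simp [apex, pt, midpoint_eq_smul_add] <;> ring
  simp [refineEdge, ha, hm, pt_zero_zero, pt_one_zero]

/-- The length of `e` cancels, so comparing distances reduces to a polynomial inequality in the
coordinates. -/
theorem mul_dist_pt_le {e : Plane × Plane} {s t s' t' u v u' v' m n : ℝ} (hn : 0 ≤ n)
    (h : m ^ 2 * ((s - s') ^ 2 + 3 * (t - t') ^ 2) ≤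
      n ^ 2 * ((u - u') ^ 2 + 3 * (v - v') ^ 2)) :
    m * dist (pt e s t) (pt e s' t') ≤ n * dist (pt e u v) (pt e u' v') := by
  rw [dist_pt, dist_pt, mul_left_comm, mul_left_comm n]
  refine mul_le_mul_of_nonneg_left ?_ dist_nonneg
  refine abs_le_of_sq_le_sq' ?_ (by positivity) |>.2
  rwa [mul_pow, mul_pow, Real.sq_sqrt (by positivity), Real.sq_sqrt (by positivity)]

theorem left_mem_triangle (e : Plane × Plane) : e.1 ∈ triangle e :=
  ⟨0, 0, (pt_zero_zero e).symm, by norm_num⟩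

theorem right_mem_triangle (e : Plane × Plane) : e.2 ∈ triangle e :=
  ⟨1, 0, (pt_one_zero e).symm, by norm_num⟩

theorem segment_subset_triangle (e : Plane × Plane) : segment ℝ e.1 e.2 ⊆ triangle e := by
  rw [segment_eq_image']
  rintro _ ⟨r, ⟨h0, h1⟩, rfl⟩
  exact ⟨r, 0, by simp [pt], le_rfl, by linarith, by linarith⟩

/-- The apex angle is 120°, so the base is the longest side and hence the diameter. -/
theorem dist_le_of_mem_triangle {e : Plane × Plane} {x y : Plane} (hx : x ∈ triangle e)
    (hy : y ∈ triangle e) : dist x y ≤ dist e.1 e.2 := by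
  obtain ⟨s, t, rfl, h1, h2, h3⟩ := hx
  obtain ⟨s', t', rfl, h1', h2', h3'⟩ := hy
  have := mul_dist_pt_le (e := e) (s := s) (t := t) (s' := s') (t' := t')
    (u := 0) (v := 0) (u' := 1) (v' := 0) (m := 1) (n := 1) zero_le_one (by
      rcases le_total s s' with h | h <;> rcases le_total t t' with h' | h' <;>
      nlinarith)
  simpa [pt_zero_zero, pt_one_zero] using this

theorem dist_of_mem_refineEdge {e f : Plane × Plane} (hf : f ∈ refineEdge e) :
    dist f.1 f.2 = dist e.1 e.2 / 3 := by
  rw [refineEdge_eq] at hf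
  simp only [List.mem_cons, List.not_mem_nil, or_false] at hf
  have h9 : √(9⁻¹ : ℝ) = 3⁻¹ := by
    rw [Real.sqrt_eq_iff_mul_self_eq_of_pos] <;> norm_num
  rcases hf with rfl | rfl | rfl | rfl <;> rw [dist_pt] <;> norm_num [h9] <;> ring

theorem triangle_subset_of_mem_refineEdge {e f : Plane × Plane} (hf : f ∈ refineEdge e) :
    triangle f ⊆ triangle e := by
  rw [refineEdge_eq] at hf
  simp only [List.mem_cons, List.not_mem_nil, or_false] at hf
  rcases hf with rfl | rfl | rfl | rfl <;> rintro _ ⟨s, t, rfl, h1, h2, h3⟩ <;> rw [pt_pt] <;>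
    refine ⟨_, _, rfl, ?_, ?_, ?_⟩ <;> linarith

/-! ### Separation of the four child triangles -/

/-- The triangles over `f` and `g` share the vertex `f.2 = g.1`, and no point of one can be
closer to the other triangle than two thirds of its distance to this vertex. -/
def Touch (f g : Plane × Plane) : Prop :=
  f.2 = g.1 ∧ ∀ x ∈ triangle f, ∀ y ∈ triangle g,
    2 * dist x f.2 ≤ 3 * dist x y ∧ 2 * dist y f.2 ≤ 3 * dist x y

/-- The triangles over `f` and `g` are at distance at least a sixth of the length of `e`. -/
def Far (e f g : Plane × Plane) : Prop :=
  ∀ x ∈ triangle f, ∀ y ∈ triangle g, dist e.1 e.2 ≤ 6 * dist x y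

theorem Far.symm {e f g : Plane × Plane} (h : Far e f g) : Far e g f := fun x hx y hy => by
  rw [dist_comm x y]
  exact h y hy x hx

theorem Touch.eq_of_mem {f g : Plane × Plane} (h : Touch f g) {x : Plane} (hf : x ∈ triangle f)
    (hg : x ∈ triangle g) : x = f.2 := by
  have := (h.2 x hf x hg).1
  rw [dist_self] at this
  exact dist_le_zero.1 (by linarith)

theorem Far.notMem {e f g : Plane × Plane} (h : Far e f g) (he : e.1 ≠ e.2) {x : Plane}
    (hf : x ∈ triangle f) : x ∉ triangle g := fun hg => by
  have := h x hf x hg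
  rw [dist_self, mul_zero] at this
  exact he (dist_le_zero.1 this)

theorem touch_zero_one (e : Plane × Plane) :
    Touch (pt e 0 0, pt e (1 / 3) 0) (pt e (1 / 3) 0, pt e (1 / 2) (1 / 6)) := by
  refine ⟨rfl, ?_⟩
  rintro _ ⟨s, t, rfl, h1, h2, h3⟩ _ ⟨s', t', rfl, h1', h2', h3'⟩
  simp only [pt_pt]
  -- `t, α` and `t', β` are nonnegative coordinates in the two cones at the shared vertex. The sharp
  -- factor for a 60° gap is `√3 / 2`; the rational `2 / 3` leaves slack.
  obtain ⟨α, rfl⟩ : ∃ α, s = 1 - 3 * t - α := ⟨1 - 3 * t - s, by ring⟩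
  obtain ⟨β, rfl⟩ : ∃ β, s' = 3 * t' + β := ⟨s' - 3 * t', by ring⟩
  have hα : 0 ≤ α := by linarith
  have hβ : 0 ≤ β := by linarith
  constructor <;> refine mul_dist_pt_le (by norm_num) ?_ <;>
    nlinarith [mul_nonneg hα hβ, mul_nonneg hα h1, mul_nonneg hα h1', mul_nonneg hβ h1,
      mul_nonneg hβ h1', mul_nonneg h1 h1', sq_nonneg (t - t'), sq_nonneg (α - β),
      sq_nonneg (2 * t - β), sq_nonneg (t - β), sq_nonneg (3 * t - 2 * t')]

theorem touch_one_two (e : Plane × Plane) :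
    Touch (pt e (1 / 3) 0, pt e (1 / 2) (1 / 6)) (pt e (1 / 2) (1 / 6), pt e (2 / 3) 0) := by
  refine ⟨rfl, ?_⟩
  rintro _ ⟨s, t, rfl, h1, h2, h3⟩ _ ⟨s', t', rfl, h1', h2', h3'⟩
  simp only [pt_pt]
  obtain ⟨α, rfl⟩ : ∃ α, s = 1 - 3 * t - α := ⟨1 - 3 * t - s, by ring⟩
  obtain ⟨β, rfl⟩ : ∃ β, s' = 3 * t' + β := ⟨s' - 3 * t', by ring⟩
  have hα : 0 ≤ α := by linarith
  have hβ : 0 ≤ β := by linarith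
  constructor <;> refine mul_dist_pt_le (by norm_num) ?_ <;>
    nlinarith [mul_nonneg hα hβ, mul_nonneg hα h1, mul_nonneg hα h1', mul_nonneg hβ h1,
      mul_nonneg hβ h1', mul_nonneg h1 h1', sq_nonneg (t - t'), sq_nonneg (α - β),
      sq_nonneg (2 * t - β), sq_nonneg (t - β), sq_nonneg (3 * t - 2 * t')]

theorem touch_two_three (e : Plane × Plane) :
    Touch (pt e (1 / 2) (1 / 6), pt e (2 / 3) 0) (pt e (2 / 3) 0, pt e 1 0) := by
  refine ⟨rfl, ?_⟩
  rintro _ ⟨s, t, rfl, h1, h2, h3⟩ _ ⟨s', t', rfl, h1', h2', h3'⟩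
  simp only [pt_pt]
  obtain ⟨α, rfl⟩ : ∃ α, s = 1 - 3 * t - α := ⟨1 - 3 * t - s, by ring⟩
  obtain ⟨β, rfl⟩ : ∃ β, s' = 3 * t' + β := ⟨s' - 3 * t', by ring⟩
  have hα : 0 ≤ α := by linarith
  have hβ : 0 ≤ β := by linarith
  constructor <;> refine mul_dist_pt_le (by norm_num) ?_ <;>
    nlinarith [mul_nonneg hα hβ, mul_nonneg hα h1, mul_nonneg hα h1', mul_nonneg hβ h1,
      mul_nonneg hβ h1', mul_nonneg h1 h1', sq_nonneg (t - t'), sq_nonneg (α - β),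
      sq_nonneg (2 * t - β), sq_nonneg (t - β), sq_nonneg (3 * t - 2 * t')]

/-- Projection onto the line of `e` suffices: the child triangles project to `[0, 1/3]`, `[1/3,
1/2]`, `[1/2, 2/3]`, `[2/3, 1]`. -/
theorem dist_le_mul_dist_pt {e : Plane × Plane} {s t s' t' n : ℝ} (hn : 0 ≤ n)
    (h : 1 ≤ n * (s' - s)) :
    dist e.1 e.2 ≤ n * dist (pt e s t) (pt e s' t') := by
  have := mul_dist_pt_le (e := e) (s := 0) (t := 0) (s' := 1) (t' := 0)
    (u := s) (v := t) (u' := s') (v' := t') (m := 1) (n := n) hn (by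
      nlinarith [mul_nonneg (sq_nonneg n) (sq_nonneg (t - t'))])
  simpa [pt_zero_zero, pt_one_zero] using this

theorem far_zero_two (e : Plane × Plane) :
    Far e (pt e 0 0, pt e (1 / 3) 0) (pt e (1 / 2) (1 / 6), pt e (2 / 3) 0) := by
  rintro _ ⟨s, t, rfl, h1, h2, h3⟩ _ ⟨s', t', rfl, h1', h2', h3'⟩
  simp only [pt_pt]
  exact dist_le_mul_dist_pt (by norm_num) (by linarith)

theorem far_zero_three (e : Plane × Plane) :
    Far e (pt e 0 0, pt e (1 / 3) 0) (pt e (2 / 3) 0, pt e 1 0) := by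
  rintro _ ⟨s, t, rfl, h1, h2, h3⟩ _ ⟨s', t', rfl, h1', h2', h3'⟩
  simp only [pt_pt]
  exact dist_le_mul_dist_pt (by norm_num) (by linarith)

theorem far_one_three (e : Plane × Plane) :
    Far e (pt e (1 / 3) 0, pt e (1 / 2) (1 / 6)) (pt e (2 / 3) 0, pt e 1 0) := by
  rintro _ ⟨s, t, rfl, h1, h2, h3⟩ _ ⟨s', t', rfl, h1', h2', h3'⟩
  simp only [pt_pt]
  exact dist_le_mul_dist_pt (by norm_num) (by linarith)

theorem refineEdge_cases {e f g : Plane × Plane} (hf : f ∈ refineEdge e) (hg : g ∈ refineEdge e) :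
    f = g ∨ Touch f g ∨ Touch g f ∨ Far e f g := by
  rw [refineEdge_eq] at hf hg
  simp only [List.mem_cons, List.not_mem_nil, or_false] at hf hg
  have t01 := touch_zero_one e
  have t12 := touch_one_two e
  have t23 := touch_two_three e
  have f02 := far_zero_two e
  have f03 := far_zero_three e
  have f13 := far_one_three e
  have f20 := f02.symm
  have f30 := f03.symm
  have f31 := f13.symm
  rcases hf with rfl | rfl | rfl | rfl <;> rcases hg with rfl | rfl | rfl | rfl <;> tauto

/-- Only the first of the four new edges comes close to the left endpoint. -/
theorem left_cases {e f : Plane × Plane} (hf : f ∈ refineEdge e) :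
    f.1 = e.1 ∨ ∀ x ∈ triangle f, dist e.1 e.2 ≤ 3 * dist x e.1 := by
  rw [refineEdge_eq] at hf
  simp only [List.mem_cons, List.not_mem_nil, or_false] at hf
  rcases hf with rfl | rfl | rfl | rfl
  · exact Or.inl (pt_zero_zero e)
  all_goals
    refine Or.inr ?_
    rintro _ ⟨s, t, rfl, h1, h2, h3⟩
    rw [dist_comm _ e.1]
    nth_rw 2 [← pt_zero_zero e]
    rw [pt_pt]
    refine dist_le_mul_dist_pt (by norm_num) (by linarith)

/-- Only the last of the four new edges comes close to the right endpoint. -/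
theorem right_cases {e f : Plane × Plane} (hf : f ∈ refineEdge e) :
    f.2 = e.2 ∨ ∀ x ∈ triangle f, dist e.1 e.2 ≤ 3 * dist x e.2 := by
  rw [refineEdge_eq] at hf
  simp only [List.mem_cons, List.not_mem_nil, or_false] at hf
  rcases hf with rfl | rfl | rfl | rfl
  rotate_left 3
  · exact Or.inl (pt_one_zero e)
  all_goals
    refine Or.inr ?_
    rintro _ ⟨s, t, rfl, h1, h2, h3⟩
    nth_rw 2 [← pt_one_zero e]
    rw [pt_pt]
    refine dist_le_mul_dist_pt (by norm_num) (by linarith)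

/-! ### Top-down recursion -/

/-- The Koch construction of depth `n` over the edge `e`, refining from the top down. -/
noncomputable def kochFrom : ℕ → Plane × Plane → List (Plane × Plane)
  | 0, e => [e]
  | n + 1, e => (refineEdge e).flatMap (kochFrom n)

/-- All endpoints of the edges in a list. -/
def endpoints (L : List (Plane × Plane)) : Set Plane :=
  {x | ∃ e ∈ L, x = e.1 ∨ x = e.2}

/-- `kochEdges` refines at the finest scale, whereas the inductions split at the coarsest;
associativity of `flatMap` identifies the two. -/
theorem kochFrom_succ' (n : ℕ) (e : Plane × Plane) :
    kochFrom (n + 1) e = (kochFrom n e).flatMap refineEdge := by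
  induction n generalizing e with
  | zero => simp [kochFrom, List.flatMap_singleton']
  | succ n ih =>
    rw [kochFrom, kochFrom, List.flatMap_assoc]
    exact congrArg (List.flatMap · (refineEdge e)) (funext ih)

theorem kochEdges_eq (n : ℕ) : kochEdges n = kochFrom n (!₂[0, 0], !₂[1, 0]) := by
  induction n with
  | zero => rfl
  | succ n ih => rw [kochEdges, ih, kochFrom_succ']

theorem mem_kochFrom_succ {n : ℕ} {e f : Plane × Plane} :
    f ∈ kochFrom (n + 1) e ↔ ∃ c ∈ refineEdge e, f ∈ kochFrom n c := by
  simp [kochFrom]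

theorem mem_endpoints_kochFrom_succ {n : ℕ} {e : Plane × Plane} {x : Plane} :
    x ∈ endpoints (kochFrom (n + 1) e) ↔ ∃ c ∈ refineEdge e, x ∈ endpoints (kochFrom n c) := by
  simp only [endpoints, Set.mem_ofPred_eq, mem_kochFrom_succ]
  grind

theorem left_ne_right_of_mem_refineEdge {e f : Plane × Plane} (he : e.1 ≠ e.2)
    (hf : f ∈ refineEdge e) : f.1 ≠ f.2 := by
  rw [← dist_pos, dist_of_mem_refineEdge hf]
  linarith [dist_pos.2 he]

theorem triangle_subset_of_mem_kochFrom {n : ℕ} {e f : Plane × Plane} (hf : f ∈ kochFrom n e) :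
    triangle f ⊆ triangle e := by
  induction n generalizing e with
  | zero => rw [List.mem_singleton.1 hf]
  | succ n ih =>
    obtain ⟨c, hc, hf⟩ := mem_kochFrom_succ.1 hf
    exact (ih hf).trans (triangle_subset_of_mem_refineEdge hc)

theorem endpoints_subset_triangle (n : ℕ) (e : Plane × Plane) :
    endpoints (kochFrom n e) ⊆ triangle e := by
  rintro x ⟨f, hf, rfl | rfl⟩
  · exact triangle_subset_of_mem_kochFrom hf (left_mem_triangle f)
  · exact triangle_subset_of_mem_kochFrom hf (right_mem_triangle f)

/-! ### Planarity -/

theorem eq_left_of_mem_triangle {n : ℕ} {e f : Plane × Plane} (he : e.1 ≠ e.2)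
    (hf : f ∈ kochFrom n e) (h : e.1 ∈ triangle f) : e.1 = f.1 := by
  induction n generalizing e with
  | zero => rw [List.mem_singleton.1 hf]
  | succ n ih =>
    obtain ⟨c, hc, hf⟩ := mem_kochFrom_succ.1 hf
    rcases left_cases hc with hl | hl
    · rw [← hl] at h ⊢
      exact ih (left_ne_right_of_mem_refineEdge he hc) hf h
    · have := hl _ (triangle_subset_of_mem_kochFrom hf h)
      rw [dist_self, mul_zero] at this
      exact absurd (dist_le_zero.1 this) he

theorem eq_right_of_mem_triangle {n : ℕ} {e f : Plane × Plane} (he : e.1 ≠ e.2)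
    (hf : f ∈ kochFrom n e) (h : e.2 ∈ triangle f) : e.2 = f.2 := by
  induction n generalizing e with
  | zero => rw [List.mem_singleton.1 hf]
  | succ n ih =>
    obtain ⟨c, hc, hf⟩ := mem_kochFrom_succ.1 hf
    rcases right_cases hc with hl | hl
    · rw [← hl] at h ⊢
      exact ih (left_ne_right_of_mem_refineEdge he hc) hf h
    · have := hl _ (triangle_subset_of_mem_kochFrom hf h)
      rw [dist_self, mul_zero] at this
      exact absurd (dist_le_zero.1 this) he

theorem Touch.eq_of_mem_kochFrom {n : ℕ} {c d f g : Plane × Plane} (h : Touch c d)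
    (hc : c.1 ≠ c.2) (hd : d.1 ≠ d.2) (hf : f ∈ kochFrom n c) (hg : g ∈ kochFrom n d) {x : Plane}
    (hxf : x ∈ triangle f) (hxg : x ∈ triangle g) : x = f.2 ∧ x = g.1 := by
  obtain rfl := h.eq_of_mem (triangle_subset_of_mem_kochFrom hf hxf)
    (triangle_subset_of_mem_kochFrom hg hxg)
  refine ⟨eq_right_of_mem_triangle hc hf hxf, ?_⟩
  rw [h.1] at hxg ⊢
  exact eq_left_of_mem_triangle hd hg hxg

theorem eq_endpoint_of_mem_triangles {n : ℕ} {e f g : Plane × Plane} (he : e.1 ≠ e.2)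
    (hf : f ∈ kochFrom n e) (hg : g ∈ kochFrom n e) (hfg : f ≠ g) {x : Plane}
    (hxf : x ∈ triangle f) (hxg : x ∈ triangle g) :
    (x = f.1 ∨ x = f.2) ∧ (x = g.1 ∨ x = g.2) := by
  induction n generalizing e with
  | zero => exact absurd ((List.mem_singleton.1 hf).trans (List.mem_singleton.1 hg).symm) hfg
  | succ n ih =>
    obtain ⟨c, hc, hf⟩ := mem_kochFrom_succ.1 hf
    obtain ⟨d, hd, hg⟩ := mem_kochFrom_succ.1 hg
    have hc' := left_ne_right_of_mem_refineEdge he hc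
    have hd' := left_ne_right_of_mem_refineEdge he hd
    rcases refineEdge_cases hc hd with rfl | h | h | h
    · exact ih hc' hf hg
    · have := h.eq_of_mem_kochFrom hc' hd' hf hg hxf hxg
      exact ⟨Or.inr this.1, Or.inl this.2⟩
    · have := h.eq_of_mem_kochFrom hd' hc' hg hf hxg hxf
      exact ⟨Or.inl this.2, Or.inr this.1⟩
    · exact absurd (triangle_subset_of_mem_kochFrom hg hxg)
        (h.notMem he (triangle_subset_of_mem_kochFrom hf hxf))

theorem mem_segment_endpoints {n : ℕ} {e f g : Plane × Plane} (he : e.1 ≠ e.2)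
    (hf : f ∈ kochFrom n e) (hg : g ∈ kochFrom n e) (hfg : f ≠ g) {x : Plane}
    (hxf : x ∈ segment ℝ f.1 f.2) (hxg : x ∈ segment ℝ g.1 g.2) :
    (x = f.1 ∨ x = f.2) ∧ (x = g.1 ∨ x = g.2) :=
  eq_endpoint_of_mem_triangles he hf hg hfg (segment_subset_triangle f hxf)
    (segment_subset_triangle g hxg)

theorem base_ne : ((!₂[0, 0], !₂[1, 0]) : Plane × Plane).1 ≠ (!₂[0, 0], !₂[1, 0]).2 := by
  intro h
  simpa using congrArg (fun x : Plane => x 0) h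

theorem kochGraph_adj {n : ℕ} {u v : kochVertices n} (h : (kochGraph n).Adj u v) :
    ∃ f ∈ kochEdges n, segment ℝ (u : Plane) v = segment ℝ f.1 f.2 ∧
      (((u : Plane) = f.1 ∧ (v : Plane) = f.2) ∨ ((u : Plane) = f.2 ∧ (v : Plane) = f.1)) := by
  rcases ((SimpleGraph.fromRel_adj _ _ _).1 h).2 with h | h
  · exact ⟨_, h, rfl, Or.inl ⟨rfl, rfl⟩⟩
  · exact ⟨_, h, segment_symm _ _ _, Or.inr ⟨rfl, rfl⟩⟩

theorem finite_kochVertices (n : ℕ) : (kochVertices n).Finite := by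
  have : kochVertices n = Prod.fst '' {e | e ∈ kochEdges n} ∪ Prod.snd '' {e | e ∈ kochEdges n} := by
    ext x
    simp only [kochVertices, Set.mem_ofPred_eq, Set.mem_union, Set.mem_image]
    grind
  rw [this]
  exact ((List.finite_toSet _).image _).union ((List.finite_toSet _).image _)

theorem isPlaneDrawing_kochGraph (n : ℕ) : IsPlaneDrawing (kochGraph n) := by
  refine ⟨fun a b w hab hw => ?_, fun a b c d hab hcd hne => ?_⟩
  · obtain ⟨f, hf, hs, hfab⟩ := kochGraph_adj hab
    obtain ⟨g, hg, hgw⟩ := w.2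
    suffices (w : Plane) = f.1 ∨ (w : Plane) = f.2 by
      simp only [Subtype.ext_iff]
      grind
    by_cases hfg : f = g
    · rwa [hfg]
    · rw [hs] at hw
      rw [kochEdges_eq] at hf hg
      refine (mem_segment_endpoints base_ne hf hg hfg hw ?_).1
      rcases hgw with h | h <;> rw [h]
      · exact left_mem_segment _ _ _
      · exact right_mem_segment _ _ _
  · obtain ⟨f, hf, hs, hfab⟩ := kochGraph_adj hab
    obtain ⟨g, hg, hs', hgcd⟩ := kochGraph_adj hcd
    have hfg : f ≠ g := by
      rintro rfl
      refine hne (Sym2.eq_iff.2 ?_)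
      simp only [Subtype.ext_iff]
      grind
    rw [hs, hs']
    rw [kochEdges_eq] at hf hg
    rintro x ⟨hx, hx'⟩
    have := mem_segment_endpoints base_ne hf hg hfg hx hx'
    simp only [Set.mem_inter_iff, Set.mem_insert_iff, Set.mem_singleton_iff]
    grind

/-! ### Chains of edges confined to balls -/

/-- `x` and `y` are joined by a chain of edges from `L`, traversed in either direction, whose
segments all lie in `A`. -/
def Joined (L : List (Plane × Plane)) (A : Set Plane) : Plane → Plane → Prop :=
  Relation.ReflTransGen fun x y => ((x, y) ∈ L ∨ (y, x) ∈ L) ∧ segment ℝ x y ⊆ A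

theorem Joined.mono {L L' : List (Plane × Plane)} {A A' : Set Plane} {x y : Plane}
    (h : Joined L A x y) (hL : L ⊆ L') (hA : A ⊆ A') : Joined L' A' x y :=
  Relation.ReflTransGen.mono
    (fun _ _ h => ⟨h.1.imp (@hL _) (@hL _), h.2.trans hA⟩) x y h

theorem Joined.symm {L : List (Plane × Plane)} {A : Set Plane} {x y : Plane}
    (h : Joined L A x y) : Joined L A y x := by
  induction h with
  | refl => exact .refl
  | @tail y z _ hyz ih => exact .head ⟨hyz.1.symm, segment_symm ℝ y z ▸ hyz.2⟩ ih

theorem Joined.trans {L : List (Plane × Plane)} {A : Set Plane} {x y z : Plane}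
    (h : Joined L A x y) (h' : Joined L A y z) : Joined L A x z :=
  Relation.ReflTransGen.trans h h'

theorem kochFrom_subset_succ {n : ℕ} {c e : Plane × Plane} (hc : c ∈ refineEdge e) :
    kochFrom n c ⊆ kochFrom (n + 1) e :=
  fun _ hf => mem_kochFrom_succ.2 ⟨c, hc, hf⟩

theorem right_mem_endpoints (n : ℕ) (e : Plane × Plane) : e.2 ∈ endpoints (kochFrom n e) := by
  induction n generalizing e with
  | zero => exact ⟨e, List.mem_singleton.2 rfl, Or.inr rfl⟩
  | succ n ih =>
    exact mem_endpoints_kochFrom_succ.2 ⟨_, .tail _ (.tail _ (.tail _ (.head _))), ih (_, e.2)⟩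

theorem left_mem_endpoints (n : ℕ) (e : Plane × Plane) : e.1 ∈ endpoints (kochFrom n e) := by
  induction n generalizing e with
  | zero => exact ⟨e, List.mem_singleton.2 rfl, Or.inl rfl⟩
  | succ n ih =>
    exact mem_endpoints_kochFrom_succ.2 ⟨_, .head _, ih (e.1, _)⟩

theorem joined_left {n : ℕ} {e : Plane × Plane} {u : Plane} (hu : u ∈ endpoints (kochFrom n e)) :
    Joined (kochFrom n e) (triangle e) e.1 u := by
  induction n generalizing e u with
  | zero =>
    obtain ⟨f, hf, h⟩ := hu
    obtain rfl := List.mem_singleton.1 hf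
    rcases h with rfl | rfl
    · exact .refl
    · exact .single ⟨Or.inl hf, segment_subset_triangle f⟩
  | succ n ih =>
    have key (c) (hc : c ∈ refineEdge e) (v) (hv : v ∈ endpoints (kochFrom n c)) :
        Joined (kochFrom (n + 1) e) (triangle e) c.1 v :=
      (ih hv).mono (kochFrom_subset_succ hc) (triangle_subset_of_mem_refineEdge hc)
    have across (c) (hc : c ∈ refineEdge e) := key c hc _ (right_mem_endpoints n c)
    obtain ⟨c, hc, hu⟩ := mem_endpoints_kochFrom_succ.1 hu
    replace key := key c hc u hu
    simp only [refineEdge, List.forall_mem_cons] at across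
    obtain ⟨h0, h1, h2, -⟩ := across
    simp only [refineEdge, List.mem_cons, List.not_mem_nil, or_false] at hc
    rcases hc with rfl | rfl | rfl | rfl
    · exact key
    · exact h0.trans key
    · exact (h0.trans h1).trans key
    · exact ((h0.trans h1).trans h2).trans key

theorem joined_triangle {n : ℕ} {e : Plane × Plane} {u v : Plane}
    (hu : u ∈ endpoints (kochFrom n e)) (hv : v ∈ endpoints (kochFrom n e)) :
    Joined (kochFrom n e) (triangle e) u v :=
  (joined_left hu).symm.trans (joined_left hv)

theorem triangle_subset_closedBall {e : Plane × Plane} {x : Plane} {r : ℝ} (hx : x ∈ triangle e)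
    (hr : dist e.1 e.2 ≤ r) : triangle e ⊆ Metric.closedBall x r := fun _ hy =>
  (dist_le_of_mem_triangle hy hx).trans hr

/-- Descend while `u` lies in the child at `e.1`. Once it does not, the current edge is at most
three times as long as `dist u e.1`, and its whole triangle fits in the ball. -/
theorem joined_left_closedBall {n : ℕ} {e : Plane × Plane} {u : Plane}
    (hu : u ∈ endpoints (kochFrom n e)) :
    Joined (kochFrom n e) (Metric.closedBall e.1 (3 * dist u e.1)) e.1 u := by
  induction n generalizing e with
  | zero =>
    obtain ⟨f, hf, h⟩ := id hu
    obtain rfl := List.mem_singleton.1 hf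
    rcases h with rfl | rfl
    · exact .refl
    · refine (joined_left hu).mono (List.Subset.refl _)
        (triangle_subset_closedBall (left_mem_triangle f) ?_)
      rw [dist_comm f.2]
      linarith [dist_nonneg (x := f.1) (y := f.2)]
  | succ n ih =>
    obtain ⟨c, hc, huc⟩ := mem_endpoints_kochFrom_succ.1 hu
    rcases left_cases hc with hl | hl
    · rw [← hl]
      exact (ih huc).mono (kochFrom_subset_succ hc) subset_rfl
    · exact (joined_left hu).mono (List.Subset.refl _) (triangle_subset_closedBall (left_mem_triangle e)
        (hl u (endpoints_subset_triangle n c huc)))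

theorem joined_right_closedBall {n : ℕ} {e : Plane × Plane} {u : Plane}
    (hu : u ∈ endpoints (kochFrom n e)) :
    Joined (kochFrom n e) (Metric.closedBall e.2 (3 * dist u e.2)) e.2 u := by
  induction n generalizing e with
  | zero =>
    obtain ⟨f, hf, h⟩ := id hu
    obtain rfl := List.mem_singleton.1 hf
    rcases h with rfl | rfl
    · refine (joined_triangle (right_mem_endpoints 0 f) hu).mono (List.Subset.refl _)
        (triangle_subset_closedBall (right_mem_triangle f) ?_)
      linarith [dist_nonneg (x := f.1) (y := f.2)]
    · exact .refl
  | succ n ih =>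
    obtain ⟨c, hc, huc⟩ := mem_endpoints_kochFrom_succ.1 hu
    rcases right_cases hc with hl | hl
    · rw [← hl]
      exact (ih huc).mono (kochFrom_subset_succ hc) subset_rfl
    · exact (joined_triangle (right_mem_endpoints _ e) hu).mono (List.Subset.refl _)
        (triangle_subset_closedBall (right_mem_triangle e)
          (hl u (endpoints_subset_triangle n c huc)))

theorem Touch.joined {n : ℕ} {c d : Plane × Plane} (h : Touch c d) {u v : Plane}
    (hu : u ∈ endpoints (kochFrom n c)) (hv : v ∈ endpoints (kochFrom n d))
    {L : List (Plane × Plane)} (hc : kochFrom n c ⊆ L) (hd : kochFrom n d ⊆ L) :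
    Joined L (Metric.closedBall u (6 * dist u v) ∪ Metric.closedBall v (6 * dist u v)) u v := by
  obtain ⟨h1, h2⟩ := h.2 u (endpoints_subset_triangle n c hu) v (endpoints_subset_triangle n d hv)
  -- The vertex `c.2` is within `3/2 * dist u v` of `u`, and the ball about it has radius at most `3
  -- * (3/2) * dist u v`; the sum is `6 * dist u v`. The same holds at `v`.
  refine ((joined_right_closedBall hu).symm.mono hc ?_).trans (y := c.2) ?_
  · refine (Metric.closedBall_subset_closedBall' ?_).trans Set.subset_union_left
    rw [dist_comm c.2]
    linarith
  · rw [h.1] at h2 ⊢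
    refine (joined_left_closedBall hv).mono hd ?_
    refine (Metric.closedBall_subset_closedBall' ?_).trans Set.subset_union_right
    rw [dist_comm d.1]
    linarith

theorem joined_closedBall {n : ℕ} {e : Plane × Plane} {u v : Plane}
    (hu : u ∈ endpoints (kochFrom n e)) (hv : v ∈ endpoints (kochFrom n e)) :
    Joined (kochFrom n e)
      (Metric.closedBall u (6 * dist u v) ∪ Metric.closedBall v (6 * dist u v)) u v := by
  induction n generalizing e with
  | zero =>
    have hd := dist_nonneg (x := u) (y := v)
    obtain ⟨f, hf, h⟩ := id hu
    obtain rfl := List.mem_singleton.1 hf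
    rcases h with rfl | rfl
    · refine (joined_left_closedBall hv).mono (List.Subset.refl _)
        ((Metric.closedBall_subset_closedBall ?_).trans Set.subset_union_left)
      rw [dist_comm v]
      linarith
    · refine (joined_right_closedBall hv).mono (List.Subset.refl _)
        ((Metric.closedBall_subset_closedBall ?_).trans Set.subset_union_left)
      rw [dist_comm v]
      linarith
  | succ n ih =>
    obtain ⟨c, hc, huc⟩ := mem_endpoints_kochFrom_succ.1 hu
    obtain ⟨d, hd, hvd⟩ := mem_endpoints_kochFrom_succ.1 hv
    have hcL := kochFrom_subset_succ (n := n) hc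
    have hdL := kochFrom_subset_succ (n := n) hd
    rcases refineEdge_cases hc hd with rfl | h | h | h
    · exact (ih huc hvd).mono hcL subset_rfl
    · exact h.joined huc hvd hcL hdL
    · rw [Set.union_comm, dist_comm]
      exact (h.joined hvd huc hdL hcL).symm
    · exact (joined_triangle hu hv).mono (List.Subset.refl _) ((triangle_subset_closedBall
        (endpoints_subset_triangle _ e hu) (h u (endpoints_subset_triangle n c huc) v
          (endpoints_subset_triangle n d hvd))).trans Set.subset_union_left)

/-! ### From chains to paths in the graph -/

/-- Containment depends only on the start and the set of edges, so it passes from a walk to its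
`bypass`. -/
theorem walkTrace_subset_iff {S : Set Plane} {H : SimpleGraph S} {A : Set Plane} {u v : S}
    (p : H.Walk u v) :
    walkTrace p ⊆ A ↔ (u : Plane) ∈ A ∧ ∀ x y : S, s(x, y) ∈ p.edges →
      segment ℝ (x : Plane) (y : Plane) ⊆ A := by
  induction p with
  | nil => simp [walkTrace]
  | @cons u v w h p ih =>
    simp only [walkTrace, Set.union_subset_iff, ih, SimpleGraph.Walk.edges_cons, List.mem_cons]
    constructor
    · rintro ⟨h1, -, h2⟩
      refine ⟨h1 (left_mem_segment _ _ _), ?_⟩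
      rintro x y (hxy | hxy)
      · rcases Sym2.eq_iff.1 hxy with ⟨rfl, rfl⟩ | ⟨rfl, rfl⟩
        · exact h1
        · rwa [segment_symm]
      · exact h2 x y hxy
    · rintro ⟨-, h⟩
      have h1 := h u v (Or.inl rfl)
      exact ⟨h1, h1 (right_mem_segment _ _ _), fun x y hxy => h x y (Or.inr hxy)⟩

theorem Joined.exists_walk {n : ℕ} {A : Set Plane} {x y : Plane} (h : Joined (kochEdges n) A x y)
    (hx : x ∈ kochVertices n) (hy : y ∈ kochVertices n) (hxA : x ∈ A) :
    ∃ p : (kochGraph n).Walk ⟨x, hx⟩ ⟨y, hy⟩, walkTrace p ⊆ A := by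
  induction h using Relation.ReflTransGen.head_induction_on with
  | refl => exact ⟨.nil, by simpa [walkTrace] using hxA⟩
  | @head x z hxz _ ih =>
    have hz : z ∈ kochVertices n := by
      rcases hxz.1 with h | h
      · exact ⟨_, h, Or.inr rfl⟩
      · exact ⟨_, h, Or.inl rfl⟩
    obtain ⟨p, hp⟩ := ih hz (hxz.2 (right_mem_segment _ _ _))
    -- `Joined` does not exclude degenerate steps, which are no edges of the graph and are skipped.
    by_cases hne : x = z
    · subst hne
      exact ⟨p, hp⟩
    · refine ⟨.cons ((SimpleGraph.fromRel_adj _ _ _).2 ⟨by simpa using hne, hxz.1⟩) p, ?_⟩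
      exact Set.union_subset hxz.2 hp

theorem isHausdorffSpanner_kochGraph (n : ℕ) : IsHausdorffSpanner 6 (kochGraph n) := by
  classical
  rintro ⟨u, hu⟩ ⟨v, hv⟩
  have hr : 0 ≤ 6 * dist u v := by positivity
  have hu' : u ∈ endpoints (kochFrom n (!₂[0, 0], !₂[1, 0])) := kochEdges_eq n ▸ hu
  have hv' : v ∈ endpoints (kochFrom n (!₂[0, 0], !₂[1, 0])) := kochEdges_eq n ▸ hv
  have hJ := joined_closedBall hu' hv'
  rw [← kochEdges_eq] at hJ
  obtain ⟨p, hp⟩ := hJ.exists_walk hu hv (Or.inl (Metric.mem_closedBall_self hr))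
  refine ⟨p.bypass, p.bypass_isPath, ?_⟩
  have hsub := (walkTrace_subset_iff p).1 hp
  have hp' := (walkTrace_subset_iff p.bypass).2
    ⟨hsub.1, fun x y h => hsub.2 x y (p.edges_bypass_subset_edges h)⟩
  obtain ⟨x, hx, hxd⟩ := (isGreatest_pathDist p.bypass).1
  rw [← hxd]
  rcases hp' hx with h | h
  · exact (Metric.infDist_le_dist_of_mem (left_mem_segment _ _ _)).trans h
  · exact (Metric.infDist_le_dist_of_mem (right_mem_segment _ _ _)).trans h

/-! ### Arc length and unbounded stretch -/

/-- Arc length along the Koch curve extends to a function on the plane. -/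
theorem exists_arcLength (n : ℕ) {e : Plane × Plane} (he : e.1 ≠ e.2) :
    ∃ φ : Plane → ℝ, φ e.1 = 0 ∧ φ e.2 = (4 / 3) ^ n * dist e.1 e.2 ∧
      ∀ f ∈ kochFrom n e, φ f.2 - φ f.1 = dist f.1 f.2 := by
  classical
  induction n generalizing e with
  | zero =>
    refine ⟨fun x => if x = e.2 then dist e.1 e.2 else 0, by simp [he], by simp, fun f hf => ?_⟩
    obtain rfl := List.mem_singleton.1 hf
    simp [he]
  | succ n ih =>
    have ih' (c) (hc : c ∈ refineEdge e) := ih (left_ne_right_of_mem_refineEdge he hc)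
    have hdist (c) (hc : c ∈ refineEdge e) := dist_of_mem_refineEdge hc
    have hmem {f} (hf : f ∈ kochFrom (n + 1) e) := mem_kochFrom_succ.1 hf
    have hsub (c f) (hf : f ∈ kochFrom n c) := triangle_subset_of_mem_kochFrom hf
    rw [refineEdge_eq] at ih' hdist hmem
    simp only [List.forall_mem_cons] at ih' hdist
    simp only [List.mem_cons, List.not_mem_nil, or_false] at hmem
    obtain ⟨⟨φ₀, l₀, r₀, h₀⟩, ⟨φ₁, l₁, r₁, h₁⟩, ⟨φ₂, l₂, r₂, h₂⟩, ⟨φ₃, l₃, r₃, h₃⟩, -⟩ := ih'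
    have t01 := touch_zero_one e
    have t12 := touch_one_two e
    have t23 := touch_two_three e
    have f02 := far_zero_two e
    have f03 := far_zero_three e
    have f13 := far_one_three e
    have e0 := pt_zero_zero e
    have e1 := pt_one_zero e
    obtain ⟨d₀, d₁, d₂, d₃, -⟩ := hdist
    rw [d₀] at r₀
    rw [d₁] at r₁
    rw [d₂] at r₂
    rw [d₃] at r₃
    set c₀ := (pt e 0 0, pt e (1 / 3) 0) with hc₀
    set c₁ := (pt e (1 / 3) 0, pt e (1 / 2) (1 / 6)) with hc₁
    set c₂ := (pt e (1 / 2) (1 / 6), pt e (2 / 3) 0) with hc₂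
    set c₃ := (pt e (2 / 3) 0, pt e 1 0) with hc₃
    set l := (4 / 3) ^ n * (dist e.1 e.2 / 3) with hl
    -- The four potentials are glued, each shifted by the length `l` of every preceding quarter.
    -- Overlaps occur only at shared vertices, where the values agree; the last branch also serves
    -- points outside all four triangles.
    let φ : Plane → ℝ := fun x =>
      if x ∈ triangle c₀ then φ₀ x else if x ∈ triangle c₁ then l + φ₁ x
      else if x ∈ triangle c₂ then 2 * l + φ₂ x else 3 * l + φ₃ x
    have k₀ (x) (hx : x ∈ triangle c₀) : φ x = φ₀ x := if_pos hx
    have k₁ (x) (hx : x ∈ triangle c₁) : φ x = l + φ₁ x := by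
      by_cases h : x ∈ triangle c₀
      · rw [k₀ x h]
        obtain rfl := t01.eq_of_mem h hx
        rw [r₀, t01.1, l₁, add_zero]
      · simp [φ, h, hx]
    have k₂ (x) (hx : x ∈ triangle c₂) : φ x = 2 * l + φ₂ x := by
      by_cases h : x ∈ triangle c₁
      · rw [k₁ x h]
        obtain rfl := t12.eq_of_mem h hx
        rw [r₁, t12.1, l₂]
        ring
      · simp [φ, h, hx, f02.symm.notMem he hx]
    have k₃ (x) (hx : x ∈ triangle c₃) : φ x = 3 * l + φ₃ x := by
      by_cases h : x ∈ triangle c₂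
      · rw [k₂ x h]
        obtain rfl := t23.eq_of_mem h hx
        rw [r₂, t23.1, l₃]
        ring
      · simp [φ, h, f03.symm.notMem he hx, f13.symm.notMem he hx]
    refine ⟨φ, ?_, ?_, fun f hf => ?_⟩
    · rw [← e0, k₀ _ (left_mem_triangle c₀), ← l₀]
    · have : φ c₃.2 = 3 * l + φ₃ c₃.2 := k₃ _ (right_mem_triangle c₃)
      rw [r₃] at this
      rw [← e1]
      refine this.trans ?_
      rw [e1, hl]
      ring
    · obtain ⟨c, hc, hf⟩ := hmem hf
      have hs1 := hsub c f hf (left_mem_triangle f)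
      have hs2 := hsub c f hf (right_mem_triangle f)
      rcases hc with rfl | rfl | rfl | rfl
      · rw [k₀ _ hs1, k₀ _ hs2, h₀ f hf]
      · rw [k₁ _ hs1, k₁ _ hs2, ← h₁ f hf]
        ring
      · rw [k₂ _ hs1, k₂ _ hs2, ← h₂ f hf]
        ring
      · rw [k₃ _ hs1, k₃ _ hs2, ← h₃ f hf]
        ring

theorem sub_le_walkLength {S : Set Plane} {H : SimpleGraph S} {φ : Plane → ℝ}
    (hφ : ∀ u v : S, H.Adj u v → φ v - φ u ≤ dist (u : Plane) v) {u v : S} (p : H.Walk u v) :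
    φ v - φ u ≤ walkLength p := by
  induction p with
  | nil => simp [walkLength]
  | cons h p ih =>
    have := hφ _ _ h
    simp only [walkLength]
    linarith

theorem exists_not_isSpanner_kochGraph (t : ℝ) : ∃ n, ¬ IsSpanner t (kochGraph n) := by
  obtain ⟨n, hn⟩ := pow_unbounded_of_one_lt t (by norm_num : (1 : ℝ) < 4 / 3)
  refine ⟨n, fun h => ?_⟩
  obtain ⟨φ, h0, h1, hφ⟩ := exists_arcLength n base_ne
  have hl : (!₂[0, 0] : Plane) ∈ kochVertices n := by
    have := left_mem_endpoints n (!₂[0, 0], !₂[1, 0])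
    rwa [← kochEdges_eq] at this
  have hr : (!₂[1, 0] : Plane) ∈ kochVertices n := by
    have := right_mem_endpoints n (!₂[0, 0], !₂[1, 0])
    rwa [← kochEdges_eq] at this
  obtain ⟨p, -, hp⟩ := h ⟨_, hl⟩ ⟨_, hr⟩
  have hlen := sub_le_walkLength (φ := φ) (fun u v huv => ?_) p
  · have hd := dist_pos.2 base_ne
    simp only at h0 h1 hlen hp hd
    rw [h0, h1, sub_zero] at hlen
    exact absurd (le_of_mul_le_mul_right (hlen.trans hp) hd) (not_le.2 hn)
  · obtain ⟨f, hf, -, ⟨hu, hv⟩ | ⟨hu, hv⟩⟩ := kochGraph_adj huv <;> rw [hu, hv] <;>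
      rw [kochEdges_eq] at hf
    · exact (hφ f hf).le
    -- An edge traversed backwards lowers the potential.
    · linarith [hφ f hf, dist_nonneg (x := f.1) (y := f.2), dist_comm f.1 f.2]

end HausdorffSpanner

theorem mainTheorem4 :
    (∀ n : ℕ, (HausdorffSpanner.kochVertices n).Finite ∧
      HausdorffSpanner.IsPlaneDrawing (HausdorffSpanner.kochGraph n) ∧
      HausdorffSpanner.IsHausdorffSpanner 6 (HausdorffSpanner.kochGraph n)) ∧
    ∀ t : ℝ, 1 ≤ t → ∃ n : ℕ, ¬ HausdorffSpanner.IsSpanner t (HausdorffSpanner.kochGraph n) :=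
  ⟨fun n => ⟨HausdorffSpanner.finite_kochVertices n, HausdorffSpanner.isPlaneDrawing_kochGraph n,
    HausdorffSpanner.isHausdorffSpanner_kochGraph n⟩,
    fun t _ => HausdorffSpanner.exists_not_isSpanner_kochGraph t⟩
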